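/- Conventions. A dcpo is a poset (possibly empty, possibly without least element) in which every nonempty directed subset has a supremum. A map between dcpos is continuous if it is Scott continuous, that is, monotone and preserving suprema of nonempty directed sets. $Y^X$ is the dcpo of continuous maps $X\to Y$ with the pointwise order. In a dcpo, $x\ll y$ means that every nonempty directed set whose supremum is $\ge y$ has a member $\ge x$. A subset $B$ is a basis if, for every $x$, the set $\{b\in B: b\ll x\}$ is nonempty and directed with supremum $x$. A dcpo is continuous if the whole dcpo is a basis of itself. A dcpo-semilattice is a dcpo with an idempotent, commutative and associative binary operation $\cup$ that is continuous on the product; powers $D^X$ of a dcpo-semilattice $D$ carry the pointwise operation. The Plotkin powerdomain $\mathcal P(X)$ of a dcpo $X$ is the free dcpo-semilattice over $X$: a dcpo-semilattice with a continuous map $\iota\colon X\to\mathcal P(X)$ such that every continuous map $f$ from $X$ to a dcpo-semilattice $D$ factors as $f=g\circ\iota$ for a unique continuous semilattice homomorphism $g\colon\mathcal P(X)\to D$. Let $\mathbb A=\{\bot<m<\top\}$ be the three-element chain with the semilattice operation $a\cup b=a$ if $a=b$ and $a\cup b=m$ otherwise. For a dcpo $X$ let $\mathrm{hom}_{0,1}(\mathbb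 A^X,\mathbb A)$ be the set of continuous semilattice homomorphisms $\varphi\colon\mathbb A^X\to\mathbb A$ preserving the bottom and the top element. For Scott-open sets $U_1\supseteq U_2$ of $X$ write $(U_1,U_2)\in\mathbb A^X$ for the map that is $\top$ on $U_2$, $m$ on $U_1\setminus U_2$ and $\bot$ off $U_1$. For $\varphi\in\mathrm{hom}_{0,1}(\mathbb A^X,\mathbb A)$ and $U$ Scott-open, put $\varphi_1(U)=1$ if $\varphi(U,\emptyset)\ne\bot$ and $\varphi_1(U)=0$ otherwise; put $\varphi_2(U)=1$ if $\varphi(X,U)=\top$ and $\varphi_2(U)=0$ otherwise. An $\mathbb A$-valuation on $X$ is an element $\varphi$ of $\mathrm{hom}_{0,1}(\mathbb A^X,\mathbb A)$ such that, for all Scott-open $U,V$, (H1') if $\varphi_1(U)=0$ then $\varphi_2(V)=\varphi_2(U\cup V)$; (H2') if $\varphi_2(U)=1$ then $\varphi_1(V)=\varphi_1(U\cap V)$. The $\mathbb A$-valuations, with the pointwise order and the pointwise operation, form a dcpo-semilattice $\mathbb A\mathsf{val}(X)$. Let $\eta^P\colon X\to\mathbb A\mathsf{val}(X)$ be given by $\eta^P(x)(u)=u(x)$,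 and for a nonempty finite set $F\subseteq X$ let $\eta^P(F)=\bigcup_{x\in F}\eta^P(x)$, formed with the semilattice operation. Theorem. Let $X$ be a continuous dcpo. Then $\mathbb A\mathsf{val}(X)$ is isomorphic to the Plotkin powerdomain $\mathcal P(X)$, with canonical map $\eta^P$; that is, $\eta^P\colon X\to\mathbb A\mathsf{val}(X)$ is a free dcpo-semilattice over $X$, and for every free dcpo-semilattice $\iota\colon X\to P$ over $X$ there is an isomorphism of dcpo-semilattices $e\colon P\to\mathbb A\mathsf{val}(X)$ with $e\circ\iota=\eta^P$. Moreover, $\mathbb A\mathsf{val}(X)$ is a continuous dcpo, and the $\mathbb A$-valuations $\eta^P(F)$, where $F$ ranges over the nonempty finite subsets of $X$, form a basis of it. -/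

import Mathlib

universe u v

/-! ### Dcpos and continuous dcpos -/

/-- Directed complete posets: every nonempty directed subset has a supremum.
No least element is required. (Mathlib's `CompletePartialOrder` demands a least element.) -/
class Dcpo (α : Type*) [PartialOrder α] : Prop where
  exists_isLUB : ∀ d : Set α, d.Nonempty → DirectedOn (· ≤ ·) d → ∃ a, IsLUB d a

/-- The way-below relation `x ≪ y`. -/
def WayBelow {α : Type*} [PartialOrder α] (x y : α) : Prop :=
  ∀ d : Set α, d.Nonempty → DirectedOn (· ≤ ·) d → ∀ a, IsLUB d a → y ≤ a → ∃ z ∈ d, x ≤ z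

/-- `B` is a basis: for every `x`, the elements of `B` way below `x` form a (nonempty) directed
set with supremum `x`. -/
def IsDcpoBasis {α : Type*} [PartialOrder α] (B : Set α) : Prop :=
  ∀ x : α, {b | b ∈ B ∧ WayBelow b x}.Nonempty ∧
    DirectedOn (· ≤ ·) {b | b ∈ B ∧ WayBelow b x} ∧ IsLUB {b | b ∈ B ∧ WayBelow b x} x

/-- Continuous dcpos: every element is the directed supremum of the elements way below it. -/
class ContinuousDcpo (α : Type*) [PartialOrder α] : Prop extends Dcpo α where
  approx : ∀ x : α, {y | WayBelow y x}.Nonempty ∧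
    DirectedOn (· ≤ ·) {y | WayBelow y x} ∧ IsLUB {y | WayBelow y x} x

/-! ### Dcpo-semilattices -/

/-- A dcpo-semilattice: a dcpo with an idempotent, commutative, associative binary operation that
is Scott continuous on the product. The operation is in general neither the join nor the meet of
the order. -/
class DcpoSemilattice (D : Type*) [PartialOrder D] extends Dcpo D where
  /-- the semilattice operation -/
  op : D → D → D
  op_self : ∀ a, op a a = a
  op_comm : ∀ a b, op a b = op b a
  op_assoc : ∀ a b c, op (op a b) c = op a (op b c)
  op_continuous : ScottContinuous fun p : D × D => op p.1 p.2

infixl:65 " ⋓ " => DcpoSemilattice.op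

instance {D : Type*} [PartialOrder D] [DcpoSemilattice D] :
    Std.Commutative (DcpoSemilattice.op (D := D)) := ⟨DcpoSemilattice.op_comm⟩

instance {D : Type*} [PartialOrder D] [DcpoSemilattice D] :
    Std.Associative (DcpoSemilattice.op (D := D)) := ⟨DcpoSemilattice.op_assoc⟩

instance {D : Type*} [PartialOrder D] [DcpoSemilattice D] :
    Std.IdempotentOp (DcpoSemilattice.op (D := D)) := ⟨DcpoSemilattice.op_self⟩

/-- Continuous semilattice homomorphisms. -/
structure IsDcpoSemilatticeHom {D E : Type*} [PartialOrder D] [DcpoSemilattice D]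
    [PartialOrder E] [DcpoSemilattice E] (g : D → E) : Prop where
  continuous : ScottContinuous g
  map_op : ∀ a b, g (a ⋓ b) = g a ⋓ g b

/-- For a nonempty finite set `F`, the element `⋃_{x ∈ F} f x`, formed with the semilattice
operation. The starting value of the fold is one of the `f x` with `x ∈ F`; by idempotency it
does not matter which one. -/
noncomputable def finChoice {X D : Type*} [PartialOrder D] [DcpoSemilattice D] (f : X → D)
    (F : Finset X) (hF : F.Nonempty) : D :=
  F.fold DcpoSemilattice.op (f hF.choose) f

/-- `ι : X → P` exhibits the dcpo-semilattice `P` as the free dcpo-semilattice over the dcpo `X`,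
that is, as the Plotkin powerdomain of `X`; the test algebras range over the universe `v`. -/
structure IsPlotkinPowerdomain {X : Type*} [PartialOrder X] {P : Type*} [PartialOrder P]
    [DcpoSemilattice P] (ι : X → P) : Prop where
  continuous : ScottContinuous ι
  existsUnique_extension : ∀ (D : Type v) [PartialOrder D] [DcpoSemilattice D] (f : X → D),
    ScottContinuous f → ∃! g : P → D, IsDcpoSemilatticeHom g ∧ ∀ x, g (ι x) = f x

/-! ### Powers and subalgebras -/

instance instDcpoSemilatticePi {X D : Type*} [PartialOrder D] [DcpoSemilattice D] :
    DcpoSemilattice (X → D) where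
  exists_isLUB d hne hd := by
    have h : ∀ x, ∃ a, IsLUB (Function.eval x '' d) a := fun x =>
      Dcpo.exists_isLUB _ (hne.image _) (directedOn_image.2 (hd.mono fun _ _ h => h x))
    choose a ha using h
    exact ⟨a, isLUB_pi.2 ha⟩
  op f g x := f x ⋓ g x
  op_self f := funext fun x => DcpoSemilattice.op_self _
  op_comm f g := funext fun x => DcpoSemilattice.op_comm _ _
  op_assoc f g h := funext fun x => DcpoSemilattice.op_assoc _ _ _
  op_continuous := by
    intro d hne hd a ha
    rw [isLUB_pi]
    intro x
    have hev : ScottContinuous (fun p : (X → D) × (X → D) => (p.1 x, p.2 x)) := by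
      intro d hne hd a ha
      rw [isLUB_prod, isLUB_pi, isLUB_pi] at ha
      rw [isLUB_prod, ← Set.image_comp, ← Set.image_comp]
      have h1 := ha.1 x
      have h2 := ha.2 x
      rw [← Set.image_comp] at h1 h2
      exact ⟨h1, h2⟩
    have := hev.comp (DcpoSemilattice.op_continuous (D := D)) hne hd ha
    rw [← Set.image_comp]
    exact this

/-- A subset of a dcpo-semilattice that is closed under directed suprema and under the
operation is a dcpo-semilattice. -/
@[reducible] def DcpoSemilattice.subtype {D : Type*} [PartialOrder D] [DcpoSemilattice D]
    (p : D → Prop) (hsup : DirSupClosed {a | p a}) (hop : ∀ a b, p a → p b → p (a ⋓ b)) :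
    DcpoSemilattice {a // p a} :=
  have key : ∀ (d : Set {a // p a}), d.Nonempty → DirectedOn (· ≤ ·) d → ∀ a : D,
      IsLUB (Subtype.val '' d) a → ∃ h : p a, IsLUB d ⟨a, h⟩ := by
    intro d hne hd a ha
    have hpa : p a := hsup (by rintro _ ⟨b, _, rfl⟩; exact b.2) (hne.image _)
      (directedOn_image.2 hd) ha
    exact ⟨hpa, fun b hb => ha.1 ⟨b, hb, rfl⟩, fun b hb => ha.2 (by
      rintro _ ⟨c, hc, rfl⟩; exact hb hc)⟩
  have hval : ScottContinuous (Subtype.val : {a // p a} → D) := by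
    intro d hne hd a ha
    obtain ⟨b, hb⟩ := Dcpo.exists_isLUB (Subtype.val '' d) (hne.image _) (directedOn_image.2 hd)
    obtain ⟨h, hb'⟩ := key d hne hd b hb
    rw [ha.unique hb']
    exact hb
  { exists_isLUB := fun d hne hd => by
      obtain ⟨b, hb⟩ := Dcpo.exists_isLUB (Subtype.val '' d) (hne.image _)
        (directedOn_image.2 hd)
      obtain ⟨h, hb'⟩ := key d hne hd b hb
      exact ⟨_, hb'⟩
    op := fun a b => ⟨a.1 ⋓ b.1, hop _ _ a.2 b.2⟩
    op_self := fun a => Subtype.ext (DcpoSemilattice.op_self _)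
    op_comm := fun a b => Subtype.ext (DcpoSemilattice.op_comm _ _)
    op_assoc := fun a b c => Subtype.ext (DcpoSemilattice.op_assoc _ _ _)
    op_continuous := by
      intro d hne hd a ha
      have h := (hval.prod hval).comp (DcpoSemilattice.op_continuous (D := D)) hne hd ha
      have hmono : Monotone fun q : {a // p a} × {a // p a} =>
          (⟨q.1.1 ⋓ q.2.1, hop _ _ q.1.2 q.2.2⟩ : {a // p a}) := fun q r hqr =>
        (DcpoSemilattice.op_continuous (D := D)).monotone
          (show (q.1.1, q.2.1) ≤ (r.1.1, r.2.1) from ⟨hqr.1, hqr.2⟩)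
      obtain ⟨_, h'⟩ := key _ (hne.image _) (directedOn_image.2 (hd.mono fun _ _ h => hmono h))
        (a.1.1 ⋓ a.2.1) (by rw [← Set.image_comp]; exact h)
      exact h' }

/-- The exponential `D^X`: Scott continuous maps from `X` to `D` with the pointwise order. -/
abbrev ScottMap (X D : Type*) [PartialOrder X] [PartialOrder D] : Type _ :=
  {f : X → D // ScottContinuous f}

/-- Pointwise suprema of Scott continuous maps are Scott continuous. -/
theorem dirSupClosed_scottContinuous (X D : Type*) [PartialOrder X] [PartialOrder D] :
    DirSupClosed {f : X → D | ScottContinuous f} := by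
  intro s hs hne _ f hf d hdne hd a ha
  rw [isLUB_pi] at hf
  constructor
  · rintro _ ⟨x, hx, rfl⟩
    refine (hf x).2 ?_
    rintro _ ⟨g, hg, rfl⟩
    exact ((hs hg).monotone (ha.1 hx)).trans ((hf a).1 ⟨g, hg, rfl⟩)
  · intro b hb
    refine (hf a).2 ?_
    rintro _ ⟨g, hg, rfl⟩
    refine (hs hg hdne hd ha).2 ?_
    rintro _ ⟨x, hx, rfl⟩
    exact le_trans ((hf x).1 ⟨g, hg, rfl⟩) (hb ⟨x, hx, rfl⟩)

/-- The power `D^X` with the pointwise operation. -/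
instance instDcpoSemilatticeScottMap {X D : Type*} [PartialOrder X] [PartialOrder D]
    [DcpoSemilattice D] : DcpoSemilattice (ScottMap X D) :=
  DcpoSemilattice.subtype _ (dirSupClosed_scottContinuous X D) fun _ _ hf hg =>
    (hf.prodMk hg).comp (DcpoSemilattice.op_continuous (D := D))

theorem ScottMap.op_apply {X D : Type*} [PartialOrder X] [PartialOrder D] [DcpoSemilattice D]
    (f g : ScottMap X D) (x : X) : (f ⋓ g).1 x = f.1 x ⋓ g.1 x := by
  rfl

instance instBoundedOrderScottMap {X D : Type*} [PartialOrder X] [PartialOrder D]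
    [BoundedOrder D] : BoundedOrder (ScottMap X D) where
  top := ⟨fun _ => ⊤, ScottContinuous.const ⊤⟩
  le_top f x := le_top (a := f.1 x)
  bot := ⟨fun _ => ⊥, ScottContinuous.const ⊥⟩
  bot_le f x := bot_le (a := f.1 x)

/-! ### The three-element algebra -/

/-- The three-element chain `𝔸 = {⊥ < m < ⊤}`. -/
inductive Heck : Type
  | bot | may | top
  deriving DecidableEq

namespace Heck

instance : Fintype Heck := ⟨{bot, may, top}, by intro a; cases a <;> simp⟩

/-- The position of an element in the chain. -/
def rank : Heck → ℕ
  | bot => 0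
  | may => 1
  | top => 2

instance : LinearOrder Heck :=
  LinearOrder.lift' rank (by intro a b; cases a <;> cases b <;> simp [rank])

instance : BoundedOrder Heck where
  top := top
  le_top := by decide
  bot := bot
  bot_le := by decide

/-- A supremum of a nonempty set in the finite chain is attained. -/
theorem mem_of_isLUB {s : Set Heck} (hs : s.Nonempty) {a : Heck} (ha : IsLUB s a) : a ∈ s := by
  obtain ⟨b, hb, hmax⟩ := Set.exists_max_image s id s.toFinite hs
  have : a = b := ha.unique ⟨fun c hc => hmax c hc, fun c hc => hc hb⟩
  exact this ▸ hb

/-- `a ⋓ b = a` if `a = b`, and `a ⋓ b = m` otherwise. -/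
instance : DcpoSemilattice Heck where
  exists_isLUB d hne _ := by
    obtain ⟨b, hb, hmax⟩ := Set.exists_max_image d id d.toFinite hne
    exact ⟨b, fun c hc => hmax c hc, fun c hc => hc hb⟩
  op a b := if a = b then a else may
  op_self := by decide
  op_comm := by decide
  op_assoc := by decide
  op_continuous := by
    intro d hne hd a ha
    have hmono : ∀ p q : Heck × Heck, p ≤ q →
        (if p.1 = p.2 then p.1 else may) ≤ (if q.1 = q.2 then q.1 else may) := by decide
    have h := isLUB_prod.1 ha
    obtain ⟨p, hp, hp1⟩ := mem_of_isLUB (hne.image _) h.1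
    obtain ⟨q, hq, hq1⟩ := mem_of_isLUB (hne.image _) h.2
    obtain ⟨r, hr, hpr, hqr⟩ := hd p hp q hq
    have har : a ≤ r := ⟨hp1 ▸ hpr.1, hq1 ▸ hqr.2⟩
    have : a = r := le_antisymm har (ha.1 hr)
    subst this
    refine ⟨?_, fun c hc => hc ⟨a, hr, rfl⟩⟩
    rintro _ ⟨p, hp, rfl⟩
    exact hmono _ _ (ha.1 hp)

/-- First projection of `𝔸 ⊆ Σ × Σ`, where `⊥ = (0,0)`, `m = (1,0)`, `⊤ = (1,1)` and `Σ` is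
represented by the truth values. -/
def fstProj (a : Heck) : Prop := a ≠ bot

/-- Second projection of `𝔸 ⊆ Σ × Σ`. -/
def sndProj (a : Heck) : Prop := a = top

end Heck

/-! ### 𝔸-valuations -/

section Aval

variable {X : Type*} [PartialOrder X]

/-- The Scott-open subsets of `X`, ordered by inclusion. -/
abbrev ScottOpens (X : Type*) [PartialOrder X] : Type _ :=
  TopologicalSpace.Opens (Topology.WithScott X)

open Classical in
/-- The element of `𝔸^X` represented by a pair `U₁ ⊇ U₂` of Scott-open sets: it is the map
`x ↦ (x ∈ U₁, x ∈ U₂)`, that is, `⊤` on `U₂`, `m` on `U₁ \ U₂` and `⊥` off `U₁`. -/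
noncomputable def ofPair (U₁ U₂ : ScottOpens X) (_h : U₂ ≤ U₁) : ScottMap X Heck :=
  ⟨fun x => if Topology.WithScott.toScott x ∈ U₂ then Heck.top
      else if Topology.WithScott.toScott x ∈ U₁ then Heck.may else Heck.bot, by
    have hU : ∀ U : ScottOpens X, IsUpperSet (U : Set (Topology.WithScott X)) ∧
        DirSupInacc (U : Set (Topology.WithScott X)) := fun U => by
      have := (Topology.IsScott.isOpen_iff_isUpperSet_and_dirSupInaccOn (D := Set.univ)).1 U.2
      rwa [dirSupInaccOn_univ] at this
    have hmono : Monotone fun x : X => if Topology.WithScott.toScott x ∈ U₂ then Heck.top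
        else if Topology.WithScott.toScott x ∈ U₁ then Heck.may else Heck.bot := by
      intro x y hxy
      have h2 : Topology.WithScott.toScott x ∈ U₂ → Topology.WithScott.toScott y ∈ U₂ :=
        fun hx => (hU U₂).1 hxy hx
      have h1 : Topology.WithScott.toScott x ∈ U₁ → Topology.WithScott.toScott y ∈ U₁ :=
        fun hx => (hU U₁).1 hxy hx
      dsimp only
      split_ifs <;> first | decide | tauto
    intro d hne hd a ha
    refine ⟨hmono.mem_upperBounds_image ha.1, fun c hc => ?_⟩
    dsimp only
    split_ifs with h2 h1
    · obtain ⟨x, hx, hx2⟩ : ∃ x : X, x ∈ d ∧ Topology.WithScott.toScott x ∈ U₂ :=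
        (hU U₂).2 hne hd ha h2
      refine le_trans ?_ (hc ⟨x, hx, rfl⟩)
      simp only [if_pos hx2, le_refl]
    · obtain ⟨x, hx, hx1⟩ : ∃ x : X, x ∈ d ∧ Topology.WithScott.toScott x ∈ U₁ :=
        (hU U₁).2 hne hd ha h1
      refine le_trans ?_ (hc ⟨x, hx, rfl⟩)
      dsimp only
      rw [if_pos hx1]
      split_ifs <;> decide
    · exact bot_le (a := c)⟩

/-- Membership in `hom₀₁(𝔸^X, 𝔸)`: continuous semilattice homomorphisms preserving bottom and
top. -/
structure IsHomZeroOne (φ : ScottMap (ScottMap X Heck) Heck) : Prop where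
  hom : IsDcpoSemilatticeHom φ.1
  map_bot : φ.1 ⊥ = ⊥
  map_top : φ.1 ⊤ = ⊤

/-- The angelic component `φ₁ : Σ^X → Σ`, `φ₁(U) = π₁ (φ (U, ∅))`. -/
def angelic (φ : ScottMap (ScottMap X Heck) Heck) (U : ScottOpens X) : Prop :=
  (φ.1 (ofPair U ⊥ bot_le)).fstProj

/-- The demonic component `φ₂ : Σ^X → Σ`, `φ₂(U) = π₂ (φ (X, U))`. -/
def demonic (φ : ScottMap (ScottMap X Heck) Heck) (U : ScottOpens X) : Prop :=
  (φ.1 (ofPair ⊤ U le_top)).sndProj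

/-- `𝔸`-valuations: the elements `φ = (φ₁, φ₂)` of `hom₀₁(𝔸^X, 𝔸)` that satisfy the two Heckmann
conditions. -/
structure IsAval (φ : ScottMap (ScottMap X Heck) Heck) : Prop extends IsHomZeroOne φ where
  heckmann_one : ∀ U V : ScottOpens X, ¬ angelic φ U → (demonic φ V ↔ demonic φ (U ⊔ V))
  heckmann_two : ∀ U V : ScottOpens X, demonic φ U → (angelic φ V ↔ angelic φ (U ⊓ V))

/-- The poset `𝔸val(X)` of `𝔸`-valuations, ordered pointwise. -/
abbrev Aval (X : Type*) [PartialOrder X] : Type _ :=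
  {φ : ScottMap (ScottMap X Heck) Heck // IsAval φ}

/-- Directed suprema in a power of `𝔸` are pointwise, and at three given points they are attained
by one member of the family. -/
theorem exists_mem_eq_three {Y : Type*} [PartialOrder Y] {d : Set (ScottMap Y Heck)}
    (hne : d.Nonempty) (hd : DirectedOn (· ≤ ·) d) {φ : ScottMap Y Heck} (hφ : IsLUB d φ)
    (a b c : Y) : ∃ ψ ∈ d, φ.1 a = ψ.1 a ∧ φ.1 b = ψ.1 b ∧ φ.1 c = ψ.1 c := by
  have hpt : ∀ y, ∃ ψ ∈ d, φ.1 y = ψ.1 y := by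
    intro y
    have hd' : DirectedOn (· ≤ ·) (Subtype.val '' d) := directedOn_image.2 hd
    obtain ⟨f, hf⟩ := Dcpo.exists_isLUB (Subtype.val '' d) (hne.image _) hd'
    have hfc : ScottContinuous f := dirSupClosed_scottContinuous Y Heck
      (by rintro _ ⟨g, _, rfl⟩; exact g.2) (hne.image _) hd' hf
    have hle : f ≤ φ.1 := hf.2 (by rintro _ ⟨g, hg, rfl⟩; exact hφ.1 hg)
    have hge : φ ≤ ⟨f, hfc⟩ := hφ.2 fun g hg => hf.1 ⟨g, hg, rfl⟩
    have heq : φ.1 = f := le_antisymm hge hle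
    obtain ⟨_, ⟨ψ, hψ, rfl⟩, h⟩ :=
      Heck.mem_of_isLUB ((hne.image _).image _) (isLUB_pi.1 hf y)
    exact ⟨ψ, hψ, by rw [heq]; exact h.symm⟩
  obtain ⟨ψ₁, h₁, e₁⟩ := hpt a
  obtain ⟨ψ₂, h₂, e₂⟩ := hpt b
  obtain ⟨ψ₃, h₃, e₃⟩ := hpt c
  obtain ⟨ψ₄, h₄, h₁₄, h₂₄⟩ := hd _ h₁ _ h₂
  obtain ⟨ψ, hψ, h₄', h₃'⟩ := hd _ h₄ _ h₃
  exact ⟨ψ, hψ, le_antisymm (e₁ ▸ (h₁₄.trans h₄') a) (hφ.1 hψ a),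
    le_antisymm (e₂ ▸ (h₂₄.trans h₄') b) (hφ.1 hψ b), le_antisymm (e₃ ▸ h₃' c) (hφ.1 hψ c)⟩

theorem dirSupClosed_isAval (X : Type*) [PartialOrder X] :
    DirSupClosed {φ : ScottMap (ScottMap X Heck) Heck | IsAval φ} := by
  intro d hsub hne hd φ hφ
  refine ⟨⟨⟨φ.2, fun a b => ?_⟩, ?_, ?_⟩, fun U V => ?_, fun U V => ?_⟩
  · obtain ⟨ψ, hψ, e₁, e₂, e₃⟩ := exists_mem_eq_three hne hd hφ a b (a ⋓ b)
    rw [e₁, e₂, e₃]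
    exact (hsub hψ).hom.map_op a b
  · obtain ⟨ψ, hψ, e, -⟩ := exists_mem_eq_three hne hd hφ ⊥ ⊥ ⊥
    rw [e]; exact (hsub hψ).map_bot
  · obtain ⟨ψ, hψ, e, -⟩ := exists_mem_eq_three hne hd hφ ⊤ ⊤ ⊤
    rw [e]; exact (hsub hψ).map_top
  · obtain ⟨ψ, hψ, e₁, e₂, e₃⟩ := exists_mem_eq_three hne hd hφ (ofPair U ⊥ bot_le)
      (ofPair ⊤ V le_top) (ofPair ⊤ (U ⊔ V) le_top)
    simp only [angelic, demonic, e₁, e₂, e₃]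
    exact (hsub hψ).heckmann_one U V
  · obtain ⟨ψ, hψ, e₁, e₂, e₃⟩ := exists_mem_eq_three hne hd hφ (ofPair ⊤ U le_top)
      (ofPair V ⊥ bot_le) (ofPair (U ⊓ V) ⊥ bot_le)
    simp only [angelic, demonic, e₁, e₂, e₃]
    exact (hsub hψ).heckmann_two U V

theorem IsAval.op {φ ψ : ScottMap (ScottMap X Heck) Heck} (hφ : IsAval φ) (hψ : IsAval ψ) :
    IsAval (φ ⋓ ψ) := by
  have hval : ∀ u, (φ ⋓ ψ).1 u = φ.1 u ⋓ ψ.1 u := fun _ => rfl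
  have h1 : ∀ a b : Heck, (a ⋓ b).fstProj ↔ a.fstProj ∨ b.fstProj := by
    unfold Heck.fstProj; decide
  have h2 : ∀ a b : Heck, (a ⋓ b).sndProj ↔ a.sndProj ∧ b.sndProj := by
    unfold Heck.sndProj; decide
  have hang : ∀ U, angelic (φ ⋓ ψ) U ↔ angelic φ U ∨ angelic ψ U := fun U => by
    unfold angelic; rw [hval, h1]
  have hdem : ∀ U, demonic (φ ⋓ ψ) U ↔ demonic φ U ∧ demonic ψ U := fun U => by
    unfold demonic; rw [hval, h2]
  refine ⟨⟨⟨(φ ⋓ ψ).2, fun a b => ?_⟩, ?_, ?_⟩, fun U V h => ?_, fun U V h => ?_⟩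
  · rw [hval, hval, hval, hφ.hom.map_op, hψ.hom.map_op]
    generalize φ.1 a = p, φ.1 b = q, ψ.1 a = r, ψ.1 b = s
    revert p q r s
    decide
  · rw [hval, hφ.map_bot, hψ.map_bot]; decide
  · rw [hval, hφ.map_top, hψ.map_top]; decide
  · rw [hang, not_or] at h
    rw [hdem, hdem, hφ.heckmann_one U V h.1, hψ.heckmann_one U V h.2]
  · rw [hdem] at h
    rw [hang, hang, hφ.heckmann_two U V h.1, hψ.heckmann_two U V h.2]

/-- The dcpo-semilattice `𝔸val(X)`, a dcpo-subsemilattice of the power `𝔸^(𝔸^X)`. -/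
instance instDcpoSemilatticeAval : DcpoSemilattice (Aval X) :=
  DcpoSemilattice.subtype _ (dirSupClosed_isAval X) fun _ _ hφ hψ => hφ.op hψ

/-- Evaluation at a point, `u ↦ u x`. -/
def evalMap (x : X) : ScottMap (ScottMap X Heck) Heck :=
  ⟨fun u => u.1 x, by
    intro d hne hd φ hφ
    refine ⟨?_, fun c hc => ?_⟩
    · rintro _ ⟨ψ, hψ, rfl⟩
      exact hφ.1 hψ x
    · obtain ⟨ψ, hψ, e, -⟩ := exists_mem_eq_three hne hd hφ x x x
      exact le_of_eq_of_le e (hc ⟨ψ, hψ, rfl⟩)⟩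

theorem isAval_evalMap (x : X) : IsAval (evalMap x) := by
  have hang : ∀ U : ScottOpens X,
      angelic (evalMap x) U ↔ Topology.WithScott.toScott x ∈ U := fun U => by
    simp only [angelic, evalMap, ofPair, Heck.fstProj]
    split_ifs with h1 h2 <;> simp_all
  have hdem : ∀ U : ScottOpens X,
      demonic (evalMap x) U ↔ Topology.WithScott.toScott x ∈ U := fun U => by
    simp only [demonic, evalMap, ofPair, Heck.sndProj]
    split_ifs with h1 h2 <;> simp_all
  refine ⟨⟨⟨(evalMap x).2, fun a b => rfl⟩, rfl, rfl⟩, fun U V h => ?_, fun U V h => ?_⟩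
  · rw [hang] at h
    rw [hdem, hdem, TopologicalSpace.Opens.mem_sup]
    tauto
  · rw [hdem] at h
    rw [hang, hang, TopologicalSpace.Opens.mem_inf]
    tauto

/-- The canonical map `η : X → 𝔸val(X)`, `η(x)(u) = u(x)`. -/
def etaP (x : X) : Aval X := ⟨evalMap x, isAval_evalMap x⟩

end Aval

/-! ### The way-below relation -/

section WayBelow

variable {X : Type*} [PartialOrder X]

/-! The two projections embed 𝔸 into Σ × Σ, turning `⋓` into "or" on the first coordinate and "and"
on the second. A homomorphism φ preserving bottom and top is therefore a pair: φ(U₁, U₂) is given by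
φ₁(U₁) and φ₂(U₂), where φ₁ preserves finite unions, φ₂ preserves finite intersections, and both
preserve directed unions. For η(F) the pair reads "F meets U" and "F is contained in U".

Write ↟x for the open set of elements that x is way below, and ↟F for the union of these sets over x
∈ F. A finite F approximates φ if φ₁(↟x) = 1 for every x ∈ F and φ₂(↟F) = 1. The crux is
`Aval.exists_approximates`: if φ₂(U) = 1 and φ₁(V) = 1 for finitely many V, some approximating H
lies in U and meets every V. The Heckmann conditions are used here: the first discards points x with
φ₁(↟x) = 0 from a finite set, the second moves the witness for V into U.

The choices f(F) over approximating F are directed for every monotone f, by comparison in the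
Egli–Milner order. For f = η they are way below φ and have supremum φ, which gives the basis and
continuity. For a continuous f into a dcpo-semilattice, their supremum defines the extension of f at
φ; uniqueness holds because a continuous homomorphism is determined by its values on the η(F). -/

theorem WayBelow.mono {w x y z : X} (hwx : w ≤ x) (h : WayBelow x y) (hyz : y ≤ z) :
    WayBelow w z := fun d hne hd a ha hza => by
  obtain ⟨b, hb, hxb⟩ := h d hne hd a ha (hyz.trans hza)
  exact ⟨b, hb, hwx.trans hxb⟩

theorem WayBelow.le {x y : X} (h : WayBelow x y) : x ≤ y := by
  obtain ⟨z, hz, hxz⟩ := h {y} (Set.singleton_nonempty y) (directedOn_singleton y) y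
    isLUB_singleton le_rfl
  exact hxz.trans_eq hz

/-- Interpolation: the elements lying two way-below steps under `y` already form a directed set with
supremum `y`, so one of them is above `x`. -/
theorem WayBelow.exists_between [ContinuousDcpo X] {x y : X} (h : WayBelow x y) :
    ∃ z, WayBelow x z ∧ WayBelow z y := by
  obtain ⟨hne, hdir, hlub⟩ := ContinuousDcpo.approx y
  obtain ⟨w, ⟨z, hwz, hzy⟩, hxw⟩ := h {w | ∃ z, WayBelow w z ∧ WayBelow z y}
    (by
      obtain ⟨z, hz⟩ := hne
      obtain ⟨w, hw⟩ := (ContinuousDcpo.approx z).1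
      exact ⟨w, z, hw, hz⟩)
    (by
      rintro w₁ ⟨z₁, hw₁, hz₁⟩ w₂ ⟨z₂, hw₂, hz₂⟩
      obtain ⟨z, hz, h₁, h₂⟩ := hdir z₁ hz₁ z₂ hz₂
      obtain ⟨w, hw, h₃, h₄⟩ := (ContinuousDcpo.approx z).2.1 w₁ (hw₁.mono le_rfl h₁) w₂
        (hw₂.mono le_rfl h₂)
      exact ⟨w, ⟨z, hw, hz⟩, h₃, h₄⟩)
    y ⟨by
      rintro w ⟨z, hw, hz⟩
      exact hw.le.trans hz.le, fun b hb => hlub.2 fun z hz =>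
        (ContinuousDcpo.approx z).2.2.2 fun w hw => hb ⟨z, hw, hz⟩⟩ le_rfl
  exact ⟨z, hwz.mono hxw le_rfl, hzy⟩

/-- A subset of the elements way below `x` that is directed with supremum `x` may be enlarged to
any set of elements way below `x`. -/
theorem approx_of_subset {x : X} {S T : Set X} (hST : S ⊆ T) (hT : ∀ t ∈ T, WayBelow t x)
    (hne : S.Nonempty) (hd : DirectedOn (· ≤ ·) S) (hx : IsLUB S x) :
    T.Nonempty ∧ DirectedOn (· ≤ ·) T ∧ IsLUB T x := by
  refine ⟨hne.mono hST, fun a ha b hb => ?_, fun t ht => (hT t ht).le,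
    fun c hc => hx.2 fun s hs => hc (hST hs)⟩
  -- Being way below `x`, each element of `T` lies under a member of `S`; thus `S` is cofinal in
  -- `T`.
  obtain ⟨a', ha', haa'⟩ := hT a ha S hne hd x hx le_rfl
  obtain ⟨b', hb', hbb'⟩ := hT b hb S hne hd x hx le_rfl
  obtain ⟨c, hc, hac, hbc⟩ := hd a' ha' b' hb'
  exact ⟨c, hST hc, haa'.trans hac, hbb'.trans hbc⟩

/-! ### Scott-open sets of a continuous dcpo. -/

theorem ScottOpens.isUpperSet_and_dirSupInacc (U : ScottOpens X) :
    IsUpperSet (U : Set (Topology.WithScott X)) ∧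
      DirSupInacc (U : Set (Topology.WithScott X)) := by
  have := (Topology.IsScott.isOpen_iff_isUpperSet_and_dirSupInaccOn (D := Set.univ)).1 U.2
  rwa [dirSupInaccOn_univ] at this

theorem ScottOpens.mem_of_le (U : ScottOpens X) {x y : X} (hxy : x ≤ y)
    (hx : Topology.WithScott.toScott x ∈ U) : Topology.WithScott.toScott y ∈ U :=
  U.isUpperSet_and_dirSupInacc.1 hxy hx

/-- An upper set of `X` that is inaccessible by directed suprema, as a Scott-open set. -/
def ScottOpens.mk (p : X → Prop) (hup : ∀ x y, x ≤ y → p x → p y)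
    (hin : ∀ (d : Set X) (a : X), d.Nonempty → DirectedOn (· ≤ ·) d → IsLUB d a → p a →
      ∃ x ∈ d, p x) : ScottOpens X :=
  ⟨{x | p (Topology.WithScott.ofScott x)}, by
    rw [Topology.IsScott.isOpen_iff_isUpperSet_and_dirSupInaccOn (D := Set.univ),
      dirSupInaccOn_univ]
    exact ⟨fun x y hxy hx => hup _ _ hxy hx, fun d hne hd a ha hp => hin d a hne hd ha hp⟩⟩

theorem ScottOpens.exists_wayBelow [ContinuousDcpo X] (U : ScottOpens X) {y : X}
    (hy : Topology.WithScott.toScott y ∈ U) :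
    ∃ x, Topology.WithScott.toScott x ∈ U ∧ WayBelow x y := by
  obtain ⟨hne, hdir, hlub⟩ := ContinuousDcpo.approx y
  obtain ⟨x, hx, hxU⟩ := U.isUpperSet_and_dirSupInacc.2 hne hdir hlub hy
  exact ⟨x, hxU, hx⟩

/-- The Scott-open set of the elements that `x` is way below. -/
def wayAbove [ContinuousDcpo X] (x : X) : ScottOpens X :=
  ScottOpens.mk (WayBelow x) (fun _ _ h hx => hx.mono le_rfl h) fun d a hne hd ha hx => by
    obtain ⟨z, hxz, hza⟩ := hx.exists_between
    obtain ⟨y, hy, hzy⟩ := hza d hne hd a ha le_rfl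
    exact ⟨y, hy, hxz.mono le_rfl hzy⟩

theorem mem_wayAbove [ContinuousDcpo X] {x y : X} :
    Topology.WithScott.toScott y ∈ wayAbove x ↔ WayBelow x y := Iff.rfl

/-- The Scott-open set of the elements that some member of `F` is way below. -/
def wayAboveSet [ContinuousDcpo X] (F : Finset X) : ScottOpens X :=
  F.sup wayAbove

theorem mem_wayAboveSet [ContinuousDcpo X] {F : Finset X} {y : X} :
    Topology.WithScott.toScott y ∈ wayAboveSet F ↔ ∃ x ∈ F, WayBelow x y := by
  simp only [wayAboveSet, Finset.sup_eq_iSup, TopologicalSpace.Opens.mem_iSup, mem_wayAbove,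
    exists_prop]

theorem wayAboveSet_le [ContinuousDcpo X] {F : Finset X} {U : ScottOpens X}
    (h : ∀ x ∈ F, Topology.WithScott.toScott x ∈ U) : wayAboveSet F ≤ U :=
  fun _ hy => by
    obtain ⟨x, hx, hxy⟩ := mem_wayAboveSet.1 hy
    exact U.mem_of_le hxy.le (h x hx)

theorem wayAbove_le [ContinuousDcpo X] {x : X} {U : ScottOpens X}
    (h : Topology.WithScott.toScott x ∈ U) : wayAbove x ≤ U :=
  fun _ hy => U.mem_of_le (WayBelow.le (mem_wayAbove.1 hy)) h

/-- The Scott-open sets generated by the finite subsets of `U`. -/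
theorem sSup_wayAboveSet [ContinuousDcpo X] (U : ScottOpens X) :
    sSup {W | ∃ E : Finset X, (∀ x ∈ E, Topology.WithScott.toScott x ∈ U) ∧
      W = wayAboveSet E} = U := by
  apply le_antisymm
  · refine sSup_le ?_
    rintro _ ⟨E, hE, rfl⟩
    exact wayAboveSet_le hE
  · intro y hy
    obtain ⟨x, hx, hxy⟩ := U.exists_wayBelow hy
    exact TopologicalSpace.Opens.mem_sSup.2 ⟨_, ⟨{x}, by simpa using hx, rfl⟩,
      mem_wayAboveSet.2 ⟨x, Finset.mem_singleton_self x, hxy⟩⟩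

theorem directedOn_wayAboveSet [ContinuousDcpo X] (U : ScottOpens X) :
    DirectedOn (· ≤ ·) {W | ∃ E : Finset X, (∀ x ∈ E, Topology.WithScott.toScott x ∈ U) ∧
      W = wayAboveSet E} := by
  classical
  rintro _ ⟨E, hE, rfl⟩ _ ⟨F, hF, rfl⟩
  refine ⟨_, ⟨E ∪ F, fun x hx => ?_, rfl⟩, Finset.sup_mono Finset.subset_union_left,
    Finset.sup_mono Finset.subset_union_right⟩
  exact (Finset.mem_union.1 hx).elim (hE x) (hF x)

end WayBelow

/-! ### Finite choices -/

section FinChoice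

variable {X D : Type*} [PartialOrder D] [DcpoSemilattice D]

theorem op_mono {a b c d : D} (hab : a ≤ b) (hcd : c ≤ d) : a ⋓ c ≤ b ⋓ d :=
  (DcpoSemilattice.op_continuous (D := D)).monotone
    (show (a, c) ≤ (b, d) from ⟨hab, hcd⟩)

theorem fold_op_left (f : X → D) (F : Finset X) (b c : D) :
    F.fold DcpoSemilattice.op (b ⋓ c) f = b ⋓ F.fold DcpoSemilattice.op c f := by
  classical
  induction F using Finset.induction_on with
  | empty => simp
  | insert a s ha ih =>
    rw [Finset.fold_insert ha, Finset.fold_insert ha, ih, ← DcpoSemilattice.op_assoc,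
      DcpoSemilattice.op_comm (f a) b, DcpoSemilattice.op_assoc]

theorem op_fold_of_mem (f : X → D) {F : Finset X} {a : X} (ha : a ∈ F) (c : D) :
    f a ⋓ F.fold DcpoSemilattice.op c f = F.fold DcpoSemilattice.op c f := by
  classical
  rw [← Finset.fold_insert_idem (op := DcpoSemilattice.op), Finset.insert_eq_of_mem ha]

/-- Makes the arbitrary starting value of the fold harmless: both candidates are values on `F`, so
either can be absorbed into the fold started at the other. -/
theorem finChoice_eq_fold (f : X → D) {F : Finset X} (hF : F.Nonempty) {a : X} (ha : a ∈ F) :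
    finChoice f F hF = F.fold DcpoSemilattice.op (f a) f := by
  rw [finChoice, ← op_fold_of_mem f ha, ← fold_op_left, DcpoSemilattice.op_comm, fold_op_left,
    op_fold_of_mem f hF.choose_spec]

theorem finChoice_singleton (f : X → D) (a : X) :
    finChoice f {a} (Finset.singleton_nonempty a) = f a := by
  rw [finChoice_eq_fold f _ (Finset.mem_singleton_self a), Finset.fold_singleton,
    DcpoSemilattice.op_self]

theorem finChoice_insert [DecidableEq X] (f : X → D) (a : X) {F : Finset X} (hF : F.Nonempty) :
    finChoice f (insert a F) (Finset.insert_nonempty a F) = f a ⋓ finChoice f F hF := by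
  obtain ⟨b, hb⟩ := id hF
  rw [finChoice_eq_fold f _ (Finset.mem_insert_of_mem hb), finChoice_eq_fold f hF hb,
    Finset.fold_insert_idem]

theorem finChoice_congr (f : X → D) {F G : Finset X} (h : F = G) (hF : F.Nonempty)
    (hG : G.Nonempty) : finChoice f F hF = finChoice f G hG := by
  subst h; rfl

theorem finset_nonempty_induction {p : ∀ F : Finset X, F.Nonempty → Prop}
    (singleton : ∀ a, p {a} (Finset.singleton_nonempty a))
    (insert : ∀ [DecidableEq X] (a : X) (F : Finset X) (hF : F.Nonempty), p F hF →
      p (insert a F) (Finset.insert_nonempty a F)) (F : Finset X) (hF : F.Nonempty) : p F hF := by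
  classical
  induction hF using Finset.Nonempty.cons_induction with
  | singleton a => exact singleton a
  | cons a s h hs ih =>
    simp only [Finset.cons_eq_insert]
    exact insert a s hs ih

theorem finChoice_union [DecidableEq X] (f : X → D) {F G : Finset X} (hF : F.Nonempty)
    (hG : G.Nonempty) :
    finChoice f (F ∪ G) (hF.inl) = finChoice f F hF ⋓ finChoice f G hG := by
  induction F, hF using finset_nonempty_induction with
  | singleton a =>
    rw [finChoice_singleton, ← finChoice_insert]
    rfl
  | insert a F hF ih =>
    rw [finChoice_congr f (F := insert a F) (G := Insert.insert a F) (by ext; simp) _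
      (Finset.insert_nonempty a F), finChoice_insert f a hF, DcpoSemilattice.op_assoc, ← ih,
      ← finChoice_insert]
    exact finChoice_congr f (by ext; simp [or_assoc]) _ _

theorem finChoice_mono {f g : X → D} (F : Finset X) (hF : F.Nonempty) (h : ∀ x ∈ F, f x ≤ g x) :
    finChoice f F hF ≤ finChoice g F hF := by
  induction F, hF using finset_nonempty_induction with
  | singleton a => simpa only [finChoice_singleton] using h a (Finset.mem_singleton_self a)
  | insert a F hF ih =>
    rw [finChoice_insert f a hF, finChoice_insert g a hF]
    exact op_mono (h a (Finset.mem_insert_self a F))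
      (ih fun x hx => h x (Finset.mem_insert_of_mem hx))

theorem finChoice_image {Y : Type*} [DecidableEq X] (f : X → D) (k : Y → X) (R : Finset Y)
    (hR : R.Nonempty) :
    finChoice f (R.image k) (hR.image k) = finChoice (f ∘ k) R hR := by
  obtain ⟨r, hr⟩ := id hR
  rw [finChoice_eq_fold f _ (Finset.mem_image_of_mem k hr), finChoice_eq_fold (f ∘ k) _ hr,
    Finset.fold_image_idem]
  rfl

/-- Finite choices are monotone in the Egli–Milner order. -/
theorem finChoice_le_of_egliMilner [PartialOrder X] {f : X → D} (hf : Monotone f)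
    {F G : Finset X} (hF : F.Nonempty) (hG : G.Nonempty) (h₁ : ∀ x ∈ F, ∃ y ∈ G, x ≤ y)
    (h₂ : ∀ y ∈ G, ∃ x ∈ F, x ≤ y) : finChoice f F hF ≤ finChoice f G hG := by
  classical
  -- The Egli–Milner hypotheses say that the projections of `R` are onto `F` and `G`. By idempotency
  -- both choices can then be indexed by `R`, where they compare pointwise.
  set R := (F ×ˢ G).filter fun p => p.1 ≤ p.2 with hRdef
  have hmem : ∀ p : X × X, p ∈ R ↔ (p.1 ∈ F ∧ p.2 ∈ G) ∧ p.1 ≤ p.2 := by simp [hRdef]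
  have hR : R.Nonempty := by
    obtain ⟨x, hx⟩ := hF
    obtain ⟨y, hy, hxy⟩ := h₁ x hx
    exact ⟨(x, y), (hmem _).2 ⟨⟨hx, hy⟩, hxy⟩⟩
  have hRF : R.image Prod.fst = F := by
    ext x
    rw [Finset.mem_image]
    constructor
    · rintro ⟨p, hp, rfl⟩
      exact ((hmem p).1 hp).1.1
    · intro hx
      obtain ⟨y, hy, hxy⟩ := h₁ x hx
      exact ⟨(x, y), (hmem _).2 ⟨⟨hx, hy⟩, hxy⟩, rfl⟩
  have hRG : R.image Prod.snd = G := by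
    ext y
    rw [Finset.mem_image]
    constructor
    · rintro ⟨p, hp, rfl⟩
      exact ((hmem p).1 hp).1.2
    · intro hy
      obtain ⟨x, hx, hxy⟩ := h₂ y hy
      exact ⟨(x, y), (hmem _).2 ⟨⟨hx, hy⟩, hxy⟩, rfl⟩
  rw [← finChoice_congr f hRF (hR.image _), ← finChoice_congr f hRG (hR.image _),
    finChoice_image, finChoice_image]
  exact finChoice_mono R hR fun p hp => hf ((hmem p).1 hp).2

theorem IsDcpoSemilatticeHom.map_finChoice {E : Type*} [PartialOrder E] [DcpoSemilattice E]
    {g : D → E} (hg : IsDcpoSemilatticeHom g) (f : X → D) (F : Finset X) (hF : F.Nonempty) :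
    g (finChoice f F hF) = finChoice (g ∘ f) F hF := by
  induction F, hF using finset_nonempty_induction with
  | singleton a => simp only [finChoice_singleton, Function.comp]
  | insert a F hF ih =>
    rw [finChoice_insert f a hF, finChoice_insert (g ∘ f) a hF, hg.map_op, ih]
    rfl

theorem IsDcpoSemilatticeHom.comp {E G : Type*} [PartialOrder E] [DcpoSemilattice E]
    [PartialOrder G] [DcpoSemilattice G] {h : E → G} {g : D → E} (hh : IsDcpoSemilatticeHom h)
    (hg : IsDcpoSemilatticeHom g) : IsDcpoSemilatticeHom (h ∘ g) :=
  ⟨hg.continuous.comp hh.continuous, fun a b => by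
    simp only [Function.comp, hg.map_op, hh.map_op]⟩

theorem IsDcpoSemilatticeHom.id : IsDcpoSemilatticeHom (id : D → D) :=
  ⟨ScottContinuous.id, fun _ _ => rfl⟩

/-- The supremum of two directed sets is compatible with the operation. -/
theorem isLUB_op {S T : Set D} {a b : D} (hS : S.Nonempty) (hSd : DirectedOn (· ≤ ·) S)
    (hT : T.Nonempty) (hTd : DirectedOn (· ≤ ·) T) (ha : IsLUB S a) (hb : IsLUB T b) :
    IsLUB ((fun p : D × D => p.1 ⋓ p.2) '' S ×ˢ T) (a ⋓ b) := by
  refine DcpoSemilattice.op_continuous (hS.prod hT) (fun p hp q hq => ?_) (a := (a, b)) ?_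
  · obtain ⟨s, hs, h₁, h₂⟩ := hSd _ hp.1 _ hq.1
    obtain ⟨t, ht, h₃, h₄⟩ := hTd _ hp.2 _ hq.2
    exact ⟨(s, t), ⟨hs, ht⟩, ⟨h₁, h₃⟩, ⟨h₂, h₄⟩⟩
  · exact ha.prod hS hT hb

/-- Two free dcpo-semilattices over the same dcpo are isomorphic. -/
theorem IsPlotkinPowerdomain.exists_orderIso {X : Type*} [PartialOrder X] {P Q : Type v}
    [PartialOrder P] [DcpoSemilattice P] [PartialOrder Q] [DcpoSemilattice Q] {ι : X → P}
    {η : X → Q} (hι : IsPlotkinPowerdomain.{v} ι) (hη : IsPlotkinPowerdomain.{v} η) :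
    ∃ e : P ≃o Q, (∀ a b : P, e (a ⋓ b) = e a ⋓ e b) ∧ ∀ x : X, e (ι x) = η x := by
  obtain ⟨g, ⟨hg, hgι⟩, -⟩ := hι.existsUnique_extension Q η hη.continuous
  obtain ⟨h, ⟨hh, hhη⟩, -⟩ := hη.existsUnique_extension P ι hι.continuous
  have hhg : h ∘ g = id := (hι.existsUnique_extension P ι hι.continuous).unique
    ⟨hh.comp hg, fun x => by simp only [Function.comp, hgι, hhη]⟩ ⟨.id, fun _ => rfl⟩
  have hgh : g ∘ h = id := (hη.existsUnique_extension Q η hη.continuous).unique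
    ⟨hg.comp hh, fun x => by simp only [Function.comp, hgι, hhη]⟩ ⟨.id, fun _ => rfl⟩
  refine ⟨⟨⟨g, h, congrFun hhg, congrFun hgh⟩, fun {a b} => ⟨fun hab => ?_, fun hab =>
    hg.continuous.monotone hab⟩⟩, hg.map_op, hgι⟩
  calc a = h (g a) := (congrFun hhg a).symm
    _ ≤ h (g b) := hh.continuous.monotone hab
    _ = b := congrFun hhg b

end FinChoice

/-! ### Angelic and demonic components -/

section Components

variable {X : Type*} [PartialOrder X]

/-- The embedding of 𝔸 into Σ × Σ, through which all later comparisons of values in 𝔸 are made. -/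
theorem Heck.le_iff : ∀ a b : Heck,
    a ≤ b ↔ (a.fstProj → b.fstProj) ∧ (a.sndProj → b.sndProj) := by
  unfold Heck.fstProj Heck.sndProj; decide

theorem Heck.fstProj_op : ∀ a b : Heck, (a ⋓ b).fstProj ↔ a.fstProj ∨ b.fstProj := by
  unfold Heck.fstProj; decide

theorem Heck.sndProj_op : ∀ a b : Heck, (a ⋓ b).sndProj ↔ a.sndProj ∧ b.sndProj := by
  unfold Heck.sndProj; decide

theorem fstProj_ofPair {U₁ U₂ : ScottOpens X} {h : U₂ ≤ U₁} {x : X} :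
    ((ofPair U₁ U₂ h).1 x).fstProj ↔ Topology.WithScott.toScott x ∈ U₁ := by
  have := @h (Topology.WithScott.toScott x)
  simp only [ofPair, Heck.fstProj]
  split_ifs with h₁ h₂ <;> simp_all

theorem sndProj_ofPair {U₁ U₂ : ScottOpens X} {h : U₂ ≤ U₁} {x : X} :
    ((ofPair U₁ U₂ h).1 x).sndProj ↔ Topology.WithScott.toScott x ∈ U₂ := by
  simp only [ofPair, Heck.sndProj]
  split_ifs with h₁ h₂ <;> simp_all

theorem ScottMap.le_iff {u v : ScottMap X Heck} :
    u ≤ v ↔ ∀ x, ((u.1 x).fstProj → (v.1 x).fstProj) ∧ ((u.1 x).sndProj → (v.1 x).sndProj) :=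
  forall_congr' fun _ => Heck.le_iff _ _

/-- The two sets are the preimages of `{m, ⊤}` and `{⊤}`. They are Scott open because directed
suprema in the finite chain are attained. -/
theorem ScottMap.exists_eq_ofPair (u : ScottMap X Heck) :
    ∃ (U₁ U₂ : ScottOpens X) (h : U₂ ≤ U₁), u = ofPair U₁ U₂ h := by
  have key : ∀ a : Heck, ∃ V : ScottOpens X, ∀ x, Topology.WithScott.toScott x ∈ V ↔ a ≤ u.1 x :=
    fun a => ⟨ScottOpens.mk (fun x => a ≤ u.1 x) (fun x y hxy h => h.trans (u.2.monotone hxy))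
      fun d b hne hd hb h => by
        obtain ⟨x, hx, hxe⟩ := Heck.mem_of_isLUB (hne.image _) (u.2 hne hd hb)
        exact ⟨x, hx, h.trans_eq hxe.symm⟩, fun x => Iff.rfl⟩
  obtain ⟨U₁, h₁⟩ := key .may
  obtain ⟨U₂, h₂⟩ := key .top
  have e₁ : ∀ b : Heck, Heck.may ≤ b ↔ b.fstProj := by unfold Heck.fstProj; decide
  have e₂ : ∀ b : Heck, Heck.top ≤ b ↔ b.sndProj := by unfold Heck.sndProj; decide
  have hU : U₂ ≤ U₁ := fun x hx => (h₁ x).2 (le_trans (by decide) ((h₂ x).1 hx))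
  refine ⟨U₁, U₂, hU,
    le_antisymm (ScottMap.le_iff.2 fun x => ?_) (ScottMap.le_iff.2 fun x => ?_)⟩
  all_goals
    rw [fstProj_ofPair, sndProj_ofPair, h₁, h₂, e₁, e₂]
    exact ⟨id, id⟩

theorem ofPair_op {U₁ U₂ V₁ V₂ W₁ W₂ : ScottOpens X} {hU : U₂ ≤ U₁} {hV : V₂ ≤ V₁}
    {hW : W₂ ≤ W₁} (h₁ : U₁ ⊔ V₁ = W₁) (h₂ : U₂ ⊓ V₂ = W₂) :
    ofPair U₁ U₂ hU ⋓ ofPair V₁ V₂ hV = ofPair W₁ W₂ hW := by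
  subst h₁ h₂
  refine le_antisymm (ScottMap.le_iff.2 fun x => ?_) (ScottMap.le_iff.2 fun x => ?_)
  all_goals
    rw [ScottMap.op_apply, Heck.fstProj_op, Heck.sndProj_op]
    simp only [fstProj_ofPair, sndProj_ofPair]
    exact ⟨id, id⟩

theorem ofPair_mono {U₁ U₂ V₁ V₂ : ScottOpens X} {hU : U₂ ≤ U₁} {hV : V₂ ≤ V₁} (h₁ : U₁ ≤ V₁)
    (h₂ : U₂ ≤ V₂) : ofPair U₁ U₂ hU ≤ ofPair V₁ V₂ hV :=
  ScottMap.le_iff.2 fun x => by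
    simp only [fstProj_ofPair, sndProj_ofPair]
    exact ⟨@h₁ _, @h₂ _⟩

theorem ofPair_bot_bot : ofPair (⊥ : ScottOpens X) ⊥ bot_le = ⊥ :=
  le_antisymm (ScottMap.le_iff.2 fun x => by
    simp only [fstProj_ofPair, sndProj_ofPair]
    exact ⟨False.elim, False.elim⟩) bot_le

theorem ofPair_top_top : ofPair (⊤ : ScottOpens X) ⊤ le_top = ⊤ :=
  le_antisymm le_top (ScottMap.le_iff.2 fun x => by
    simp only [fstProj_ofPair, sndProj_ofPair]
    exact ⟨fun _ => trivial, fun _ => trivial⟩)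

/-! ### Homomorphisms as pairs of an angelic and a demonic component. -/

variable {φ ψ : ScottMap (ScottMap X Heck) Heck}

theorem angelic_mono_left (h : φ ≤ ψ) {U : ScottOpens X} (hU : angelic φ U) : angelic ψ U :=
  ((Heck.le_iff _ _).1 (h _)).1 hU

theorem demonic_mono_left (h : φ ≤ ψ) {U : ScottOpens X} (hU : demonic φ U) : demonic ψ U :=
  ((Heck.le_iff _ _).1 (h _)).2 hU

theorem angelic_mono {U V : ScottOpens X} (h : U ≤ V) (hU : angelic φ U) : angelic φ V :=
  ((Heck.le_iff _ _).1 (φ.2.monotone (ofPair_mono h le_rfl))).1 hU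

theorem demonic_mono {U V : ScottOpens X} (h : U ≤ V) (hU : demonic φ U) : demonic φ V :=
  ((Heck.le_iff _ _).1 (φ.2.monotone (ofPair_mono le_rfl h))).2 hU

theorem angelic_op {U : ScottOpens X} : angelic (φ ⋓ ψ) U ↔ angelic φ U ∨ angelic ψ U := by
  rw [angelic, ScottMap.op_apply, Heck.fstProj_op]; rfl

theorem demonic_op {U : ScottOpens X} : demonic (φ ⋓ ψ) U ↔ demonic φ U ∧ demonic ψ U := by
  rw [demonic, ScottMap.op_apply, Heck.sndProj_op]; rfl

theorem angelic_evalMap {x : X} {U : ScottOpens X} :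
    angelic (evalMap x) U ↔ Topology.WithScott.toScott x ∈ U :=
  fstProj_ofPair (h := bot_le)

theorem demonic_evalMap {x : X} {U : ScottOpens X} :
    demonic (evalMap x) U ↔ Topology.WithScott.toScott x ∈ U :=
  sndProj_ofPair (h := le_top)

/-- Combining (U₁, U₂) with the bottom (∅, ∅) yields (U₁, ∅). Since φ preserves bottom, this does
not change the first projection of the value, so U₂ is irrelevant to it. -/
theorem IsHomZeroOne.fstProj_apply_ofPair (hφ : IsHomZeroOne φ) {U₁ U₂ : ScottOpens X}
    {h : U₂ ≤ U₁} : (φ.1 (ofPair U₁ U₂ h)).fstProj ↔ angelic φ U₁ := by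
  rw [angelic, ← ofPair_op (hU := h) (hV := bot_le) (sup_bot_eq U₁) (inf_bot_eq U₂),
    hφ.hom.map_op, Heck.fstProj_op, ofPair_bot_bot, hφ.map_bot]
  exact (or_iff_left fun h => h rfl).symm

/-- The dual argument: combining with the top (X, X) yields (X, U₂), and φ preserves top. -/
theorem IsHomZeroOne.sndProj_apply_ofPair (hφ : IsHomZeroOne φ) {U₁ U₂ : ScottOpens X}
    {h : U₂ ≤ U₁} : (φ.1 (ofPair U₁ U₂ h)).sndProj ↔ demonic φ U₂ := by
  rw [demonic, ← ofPair_op (hU := h) (hV := le_top) (sup_top_eq U₁) (inf_top_eq U₂),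
    hφ.hom.map_op, Heck.sndProj_op, ofPair_top_top, hφ.map_top]
  exact (and_iff_left rfl).symm

/-- The order on `hom₀₁(𝔸^X, 𝔸)` in terms of the two components. -/
theorem IsHomZeroOne.le_of_components (hφ : IsHomZeroOne φ) (hψ : IsHomZeroOne ψ)
    (h₁ : ∀ U, angelic φ U → angelic ψ U) (h₂ : ∀ U, demonic φ U → demonic ψ U) : φ ≤ ψ := by
  intro u
  obtain ⟨U₁, U₂, h, rfl⟩ := u.exists_eq_ofPair
  rw [Heck.le_iff, hφ.fstProj_apply_ofPair, hψ.fstProj_apply_ofPair, hφ.sndProj_apply_ofPair,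
    hψ.sndProj_apply_ofPair]
  exact ⟨h₁ U₁, h₂ U₂⟩

theorem IsHomZeroOne.not_angelic_bot (hφ : IsHomZeroOne φ) : ¬ angelic φ ⊥ := by
  rw [angelic, ofPair_bot_bot, hφ.map_bot]
  exact fun h => h rfl

theorem IsHomZeroOne.demonic_top (hφ : IsHomZeroOne φ) : demonic φ ⊤ := by
  rw [demonic, ofPair_top_top, hφ.map_top]
  rfl

theorem IsHomZeroOne.not_demonic_bot (hφ : IsHomZeroOne φ) : ¬ demonic φ ⊥ := by
  rw [← hφ.sndProj_apply_ofPair (h := le_rfl), ofPair_bot_bot, hφ.map_bot]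
  exact fun h => by cases h

theorem IsHomZeroOne.angelic_sup (hφ : IsHomZeroOne φ) {U V : ScottOpens X} :
    angelic φ (U ⊔ V) ↔ angelic φ U ∨ angelic φ V := by
  rw [angelic, ← ofPair_op (hU := bot_le) (hV := bot_le) rfl (inf_bot_eq ⊥), hφ.hom.map_op,
    Heck.fstProj_op]
  rfl

theorem IsHomZeroOne.demonic_inf (hφ : IsHomZeroOne φ) {U V : ScottOpens X} :
    demonic φ (U ⊓ V) ↔ demonic φ U ∧ demonic φ V := by
  rw [demonic, ← ofPair_op (hU := le_top) (hV := le_top) (sup_top_eq ⊤) rfl, hφ.hom.map_op,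
    Heck.sndProj_op]
  rfl

theorem IsHomZeroOne.exists_angelic_of_finset_sup (hφ : IsHomZeroOne φ) {Y : Type*}
    (F : Finset Y) (U : Y → ScottOpens X) (h : angelic φ (F.sup U)) :
    ∃ y ∈ F, angelic φ (U y) := by
  classical
  induction F using Finset.induction_on with
  | empty => exact (hφ.not_angelic_bot h).elim
  | insert a s _ ih =>
    rw [Finset.sup_insert, hφ.angelic_sup] at h
    rcases h with h | h
    · exact ⟨a, Finset.mem_insert_self a s, h⟩
    · obtain ⟨y, hy, hyU⟩ := ih h
      exact ⟨y, Finset.mem_insert_of_mem hy, hyU⟩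

/-! ### Scott continuity of the two components. -/

theorem isLUB_ofPair {S : Set (ScottOpens X × ScottOpens X)}
    {p : ScottOpens X × ScottOpens X} (hp : p.2 ≤ p.1) (hSp : ∀ q ∈ S, q.2 ≤ q.1)
    (hlub : IsLUB S p) :
    IsLUB {u | ∃ (q : ScottOpens X × ScottOpens X) (hq : q ∈ S), u = ofPair q.1 q.2 (hSp q hq)}
      (ofPair p.1 p.2 hp) := by
  have h₁ : IsLUB (Prod.fst '' S) p.1 := (isLUB_prod.1 hlub).1
  have h₂ : IsLUB (Prod.snd '' S) p.2 := (isLUB_prod.1 hlub).2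
  have e₁ := h₁.sSup_eq
  have e₂ := h₂.sSup_eq
  refine ⟨?_, fun v hv => ScottMap.le_iff.2 fun x => ⟨fun hx => ?_, fun hx => ?_⟩⟩
  · rintro _ ⟨q, hq, rfl⟩
    exact ofPair_mono (hlub.1 hq).1 (hlub.1 hq).2
  · rw [fstProj_ofPair, ← e₁, TopologicalSpace.Opens.mem_sSup] at hx
    obtain ⟨_, ⟨q, hq, rfl⟩, hxq⟩ := hx
    exact (ScottMap.le_iff.1 (hv ⟨q, hq, rfl⟩) x).1 (fstProj_ofPair.2 hxq)
  · rw [sndProj_ofPair, ← e₂, TopologicalSpace.Opens.mem_sSup] at hx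
    obtain ⟨_, ⟨q, hq, rfl⟩, hxq⟩ := hx
    exact (ScottMap.le_iff.1 (hv ⟨q, hq, rfl⟩) x).2 (sndProj_ofPair.2 hxq)

/-- The two components are Scott continuous. -/
theorem exists_apply_ofPair_eq {S : Set (ScottOpens X × ScottOpens X)} (hS : S.Nonempty)
    (hd : DirectedOn (· ≤ ·) S) {p : ScottOpens X × ScottOpens X} (hp : p.2 ≤ p.1)
    (hSp : ∀ q ∈ S, q.2 ≤ q.1) (hlub : IsLUB S p) :
    ∃ (q : ScottOpens X × ScottOpens X) (hq : q ∈ S),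
      φ.1 (ofPair q.1 q.2 (hSp q hq)) = φ.1 (ofPair p.1 p.2 hp) := by
  have hne : {u | ∃ (q : ScottOpens X × ScottOpens X) (hq : q ∈ S),
      u = ofPair q.1 q.2 (hSp q hq)}.Nonempty := by
    obtain ⟨q, hq⟩ := hS
    exact ⟨_, q, hq, rfl⟩
  obtain ⟨_, ⟨q, hq, rfl⟩, h⟩ := Heck.mem_of_isLUB (hne.image _) (φ.2 hne (by
    rintro _ ⟨q, hq, rfl⟩ _ ⟨r, hr, rfl⟩
    obtain ⟨s, hs, hqs, hrs⟩ := hd q hq r hr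
    exact ⟨_, ⟨s, hs, rfl⟩, ofPair_mono hqs.1 hqs.2, ofPair_mono hrs.1 hrs.2⟩)
    (isLUB_ofPair hp hSp hlub))
  exact ⟨q, hq, h⟩

theorem exists_angelic_of_sSup {S : Set (ScottOpens X)} (hS : S.Nonempty)
    (hd : DirectedOn (· ≤ ·) S) (h : angelic φ (sSup S)) : ∃ U ∈ S, angelic φ U := by
  -- The angelic component is read off the pairs (U, ∅), so the second coordinate is held constant.
  obtain ⟨⟨U, W⟩, ⟨hU, hW⟩, e⟩ := exists_apply_ofPair_eq (φ := φ) (S := S ×ˢ {⊥})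
    (hS.prod (Set.singleton_nonempty _)) (by
      rintro ⟨U, _⟩ ⟨hU, rfl⟩ ⟨V, _⟩ ⟨hV, rfl⟩
      obtain ⟨W, hW, hUW, hVW⟩ := hd U hU V hV
      exact ⟨(W, ⊥), ⟨hW, rfl⟩, ⟨hUW, le_rfl⟩, ⟨hVW, le_rfl⟩⟩) (p := (sSup S, ⊥)) bot_le
    (by rintro ⟨U, _⟩ ⟨hU, rfl⟩; exact bot_le)
    ((isLUB_sSup S).prod hS (Set.singleton_nonempty _) isLUB_singleton)
  obtain rfl : W = ⊥ := hW
  rw [angelic, ← e] at h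
  exact ⟨_, hU, h⟩

theorem exists_demonic_of_sSup {S : Set (ScottOpens X)} (hS : S.Nonempty)
    (hd : DirectedOn (· ≤ ·) S) (h : demonic φ (sSup S)) : ∃ U ∈ S, demonic φ U := by
  obtain ⟨⟨W, U⟩, ⟨hW, hU⟩, e⟩ := exists_apply_ofPair_eq (φ := φ) (S := {⊤} ×ˢ S)
    ((Set.singleton_nonempty _).prod hS) (by
      rintro ⟨_, U⟩ ⟨rfl, hU⟩ ⟨_, V⟩ ⟨rfl, hV⟩
      obtain ⟨W, hW, hUW, hVW⟩ := hd U hU V hV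
      exact ⟨(⊤, W), ⟨rfl, hW⟩, ⟨le_rfl, hUW⟩, ⟨le_rfl, hVW⟩⟩) (p := (⊤, sSup S)) le_top
    (by rintro ⟨_, U⟩ ⟨rfl, hU⟩; exact le_top)
    (isLUB_singleton.prod (Set.singleton_nonempty _) hS (isLUB_sSup S))
  obtain rfl : W = ⊤ := hW
  rw [demonic, ← e] at h
  exact ⟨_, hU, h⟩

end Components

/-! ### Finite approximations of `𝔸`-valuations -/

section Approximation

variable {X : Type*} [PartialOrder X]

/-- At finitely many points, a directed supremum of `𝔸`-valuations is attained. -/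
theorem Aval.exists_mem_eq {d : Set (Aval X)} (hne : d.Nonempty) (hd : DirectedOn (· ≤ ·) d)
    {φ : Aval X} (hφ : IsLUB d φ) (u : ScottMap X Heck) : ∃ ψ ∈ d, φ.1.1 u = ψ.1.1 u := by
  have hd' : DirectedOn (· ≤ ·) (Subtype.val '' d) := directedOn_image.2 hd
  obtain ⟨b, hb⟩ := Dcpo.exists_isLUB (Subtype.val '' d) (hne.image _) hd'
  have hbA : IsAval b := dirSupClosed_isAval X (by rintro _ ⟨ψ, _, rfl⟩; exact ψ.2)
    (hne.image _) hd' hb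
  have : φ = ⟨b, hbA⟩ := hφ.unique ⟨fun ψ hψ => hb.1 ⟨ψ, hψ, rfl⟩, fun c hc => hb.2 (by
    rintro _ ⟨ψ, hψ, rfl⟩; exact hc hψ)⟩
  subst this
  obtain ⟨_, ⟨ψ, hψ, rfl⟩, h, -⟩ := exists_mem_eq_three (hne.image _) hd' hb u u u
  exact ⟨ψ, hψ, h⟩

theorem Aval.le_of_components {φ ψ : Aval X} (h₁ : ∀ U, angelic φ.1 U → angelic ψ.1 U)
    (h₂ : ∀ U, demonic φ.1 U → demonic ψ.1 U) : φ ≤ ψ :=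
  φ.2.toIsHomZeroOne.le_of_components ψ.2.toIsHomZeroOne h₁ h₂

theorem scottContinuous_etaP : ScottContinuous (etaP : X → Aval X) := by
  intro d hne hd a ha
  refine ⟨?_, fun φ hφ u => (u.2 hne hd ha).2 ?_⟩
  · rintro _ ⟨x, hx, rfl⟩ u
    exact u.2.monotone (ha.1 hx)
  · rintro _ ⟨x, hx, rfl⟩
    exact hφ ⟨x, hx, rfl⟩ u

theorem angelic_finChoice_etaP (F : Finset X) (hF : F.Nonempty) (U : ScottOpens X) :
    angelic (finChoice etaP F hF).1 U ↔ ∃ x ∈ F, Topology.WithScott.toScott x ∈ U := by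
  induction F, hF using finset_nonempty_induction with
  | singleton a =>
    rw [finChoice_singleton, etaP, angelic_evalMap]
    simp
  | insert a F hF ih =>
    rw [finChoice_insert etaP a hF, Finset.exists_mem_insert, ← ih,
      ← angelic_evalMap (x := a), ← angelic_op]
    rfl

theorem demonic_finChoice_etaP (F : Finset X) (hF : F.Nonempty) (U : ScottOpens X) :
    demonic (finChoice etaP F hF).1 U ↔ ∀ x ∈ F, Topology.WithScott.toScott x ∈ U := by
  induction F, hF using finset_nonempty_induction with
  | singleton a =>
    rw [finChoice_singleton, etaP, demonic_evalMap]
    simp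
  | insert a F hF ih =>
    rw [finChoice_insert etaP a hF, Finset.forall_mem_insert, ← ih,
      ← demonic_evalMap (x := a), ← demonic_op]
    rfl

/-! ### Finite sets approximating an 𝔸-valuation. -/

variable [ContinuousDcpo X]

/-- `F` approximates `φ`: every member of `F` may be strictly exceeded, and some member of `F`
must be strictly exceeded. -/
structure Approximates (F : Finset X) (φ : Aval X) : Prop where
  angelic : ∀ x ∈ F, angelic φ.1 (wayAbove x)
  demonic : demonic φ.1 (wayAboveSet F)

variable {φ ψ : Aval X} {F G : Finset X}

theorem Approximates.nonempty (h : Approximates F φ) : F.Nonempty := by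
  rw [Finset.nonempty_iff_ne_empty]
  rintro rfl
  exact φ.2.not_demonic_bot h.demonic

theorem Approximates.mono (h : Approximates F φ) (hle : φ ≤ ψ) : Approximates F ψ :=
  ⟨fun x hx => angelic_mono_left hle (h.angelic x hx), demonic_mono_left hle h.demonic⟩

theorem Approximates.op [DecidableEq X] (hF : Approximates F φ) (hG : Approximates G ψ) :
    Approximates (F ∪ G) (φ ⋓ ψ) := by
  refine ⟨fun x hx => angelic_op.2 ?_, demonic_op.2
    ⟨demonic_mono (Finset.sup_mono Finset.subset_union_left) hF.demonic,
      demonic_mono (Finset.sup_mono Finset.subset_union_right) hG.demonic⟩⟩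
  exact (Finset.mem_union.1 hx).imp (hF.angelic x) (hG.angelic x)

/-- Approximation by `F` is a Scott-open condition on `φ`: it consists of finitely many conditions
on values in 𝔸, each value of a directed supremum is attained, and directedness joins the witnesses.
Both the way-below relation and the continuity of extensions rest on this. -/
theorem Approximates.exists_mem_of_isLUB (h : Approximates F φ) {d : Set (Aval X)}
    (hne : d.Nonempty) (hd : DirectedOn (· ≤ ·) d) (hφ : IsLUB d φ) :
    ∃ ψ ∈ d, Approximates F ψ := by
  classical
  have key : ∀ E : Finset X, (∀ x ∈ E, _root_.angelic φ.1 (wayAbove x)) →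
      ∃ ψ ∈ d, ∀ x ∈ E, _root_.angelic ψ.1 (wayAbove x) := by
    intro E
    induction E using Finset.induction_on with
    | empty =>
      obtain ⟨ψ, hψ⟩ := hne
      exact fun _ => ⟨ψ, hψ, by simp⟩
    | insert a E _ ih =>
      intro hE
      rw [Finset.forall_mem_insert] at hE
      obtain ⟨ψ₁, hψ₁, e₁⟩ := ih hE.2
      obtain ⟨ψ₂, hψ₂, e₂⟩ := Aval.exists_mem_eq hne hd hφ (ofPair (wayAbove a) ⊥ bot_le)
      obtain ⟨ψ, hψ, h₁, h₂⟩ := hd ψ₁ hψ₁ ψ₂ hψ₂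
      have ha := hE.1
      rw [_root_.angelic, e₂] at ha
      exact ⟨ψ, hψ, (Finset.forall_mem_insert _ _ _).2
        ⟨angelic_mono_left h₂ ha, fun x hx => angelic_mono_left h₁ (e₁ x hx)⟩⟩
  obtain ⟨ψ₁, hψ₁, e₁⟩ := key F h.angelic
  obtain ⟨ψ₂, hψ₂, e₂⟩ := Aval.exists_mem_eq hne hd hφ (ofPair ⊤ (wayAboveSet F) le_top)
  obtain ⟨ψ, hψ, h₁, h₂⟩ := hd ψ₁ hψ₁ ψ₂ hψ₂
  have hdem := h.demonic
  rw [_root_.demonic, e₂] at hdem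
  exact ⟨ψ, hψ, fun x hx => angelic_mono_left h₁ (e₁ x hx), demonic_mono_left h₂ hdem⟩

/-- Finite approximations exist inside any given set that must be met, and they can be taken to
meet finitely many given sets that may be met. -/
theorem Aval.exists_approximates (φ : Aval X) {U : ScottOpens X} (hU : demonic φ.1 U)
    (𝒱 : Finset (ScottOpens X)) (h𝒱 : ∀ V ∈ 𝒱, angelic φ.1 V) :
    ∃ H : Finset X, Approximates H φ ∧ (∀ x ∈ H, Topology.WithScott.toScott x ∈ U) ∧
      ∀ V ∈ 𝒱, ∃ x ∈ H, Topology.WithScott.toScott x ∈ V := by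
  classical
  have hφ := φ.2.toIsHomZeroOne
  have hne : ∀ W : ScottOpens X, {V | ∃ E : Finset X,
      (∀ x ∈ E, Topology.WithScott.toScott x ∈ W) ∧ V = wayAboveSet E}.Nonempty :=
    fun W => ⟨_, ∅, by simp, rfl⟩
  -- `U` is the directed union of the sets ↟E with `E` a finite subset of `U`, so continuity of φ₂
  -- selects one of them.
  obtain ⟨_, ⟨E, hEU, rfl⟩, hE⟩ := exists_demonic_of_sSup (φ := φ.1) (hne U)
    (directedOn_wayAboveSet U) (by rwa [sSup_wayAboveSet])
  have hpt : ∀ V ∈ 𝒱, ∃ x, (Topology.WithScott.toScott x ∈ V ∧ Topology.WithScott.toScott x ∈ U) ∧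
      angelic φ.1 (wayAbove x) := by
    intro V hV
    -- The second Heckmann condition lets the witness for `V` be found inside `U`; continuity and
    -- finite additivity of φ₁ then reduce it to a single point.
    have hUV : angelic φ.1 (U ⊓ V) := (φ.2.heckmann_two U V hU).1 (h𝒱 V hV)
    obtain ⟨_, ⟨E, hE, rfl⟩, h⟩ := exists_angelic_of_sSup (φ := φ.1) (hne (U ⊓ V))
      (directedOn_wayAboveSet (U ⊓ V)) (by rwa [sSup_wayAboveSet])
    obtain ⟨x, hx, hxa⟩ := hφ.exists_angelic_of_finset_sup E wayAbove h
    exact ⟨x, ⟨(hE x hx).2, (hE x hx).1⟩, hxa⟩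
  -- `choose!` needs a default value. An empty `X` would force `E = ∅`, contradicting φ₂(∅) = 0.
  have : Nonempty X := by
    by_contra hX
    rw [not_nonempty_iff] at hX
    rw [Finset.eq_empty_of_isEmpty E] at hE
    exact hφ.not_demonic_bot hE
  choose! k hk hka using hpt
  set E' := E.filter fun x => angelic φ.1 (wayAbove x)
  have hE' : demonic φ.1 (wayAboveSet E') := by
    -- By finite additivity, φ₁ vanishes on the union of the ↟x over the discarded points, so the
    -- first Heckmann condition allows adding that union back to recover ↟E.
    rw [φ.2.heckmann_one (wayAboveSet (E.filter fun x => ¬ angelic φ.1 (wayAbove x)))]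
    · rw [wayAboveSet, wayAboveSet, ← Finset.sup_union, Finset.union_comm,
        Finset.filter_union_filter_not_eq]
      exact hE
    · intro h
      obtain ⟨x, hx, hxa⟩ := hφ.exists_angelic_of_finset_sup _ wayAbove h
      exact (Finset.mem_filter.1 hx).2 hxa
  refine ⟨E' ∪ 𝒱.image k, ⟨fun x hx => ?_,
    demonic_mono (Finset.sup_mono Finset.subset_union_left) hE'⟩, fun x hx => ?_, fun V hV =>
    ⟨k V, Finset.mem_union_right _ (Finset.mem_image_of_mem k hV), (hk V hV).1⟩⟩
  all_goals
    rcases Finset.mem_union.1 hx with hx | hx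
    swap
    · obtain ⟨V, hV, rfl⟩ := Finset.mem_image.1 hx
      first | exact hka V hV | exact (hk V hV).2
  · exact (Finset.mem_filter.1 hx).2
  · exact hEU x (Finset.mem_filter.1 hx).1

/-- Finite choices over two finite sets that approximate `φ` are dominated by one over a third. -/
theorem Approximates.exists_upper_bound {D : Type*} [PartialOrder D] [DcpoSemilattice D]
    {f : X → D} (hf : Monotone f) (hF : Approximates F φ) (hG : Approximates G φ) :
    ∃ H, ∃ hH : Approximates H φ, finChoice f F hF.nonempty ≤ finChoice f H hH.nonempty ∧
      finChoice f G hG.nonempty ≤ finChoice f H hH.nonempty := by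
  classical
  -- Lying in ↟F ∩ ↟G puts every point of `H` above points of `F` and of `G`; meeting every ↟x puts
  -- every point of `F ∪ G` below one of `H`. These are the two halves of the Egli–Milner order.
  obtain ⟨H, hH, h₁, h₂⟩ := φ.exists_approximates
    (φ.2.toIsHomZeroOne.demonic_inf.2 ⟨hF.demonic, hG.demonic⟩) ((F ∪ G).image wayAbove) (by
      intro V hV
      obtain ⟨x, hx, rfl⟩ := Finset.mem_image.1 hV
      exact (Finset.mem_union.1 hx).elim (hF.angelic x) (hG.angelic x))
  have h₃ : ∀ x ∈ F ∪ G, ∃ y ∈ H, x ≤ y := fun x hx => by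
    obtain ⟨y, hy, hxy⟩ := h₂ _ (Finset.mem_image_of_mem _ hx)
    exact ⟨y, hy, (mem_wayAbove.1 hxy).le⟩
  refine ⟨H, hH,
    finChoice_le_of_egliMilner hf _ _ (fun x hx => h₃ x (Finset.mem_union_left _ hx)) ?_,
    finChoice_le_of_egliMilner hf _ _ (fun x hx => h₃ x (Finset.mem_union_right _ hx)) ?_⟩
  · intro y hy
    obtain ⟨x, hx, hxy⟩ := mem_wayAboveSet.1 (h₁ y hy).1
    exact ⟨x, hx, hxy.le⟩
  · intro y hy
    obtain ⟨x, hx, hxy⟩ := mem_wayAboveSet.1 (h₁ y hy).2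
    exact ⟨x, hx, hxy.le⟩

/-- The finite choices `f(F)`, where `F` approximates `φ`. -/
def approxChoices {D : Type*} [PartialOrder D] [DcpoSemilattice D] (f : X → D) (φ : Aval X) :
    Set D :=
  {a | ∃ (F : Finset X) (h : Approximates F φ), a = finChoice f F h.nonempty}

theorem approxChoices_nonempty {D : Type*} [PartialOrder D] [DcpoSemilattice D] (f : X → D)
    (φ : Aval X) : (approxChoices f φ).Nonempty := by
  obtain ⟨H, hH, -⟩ := φ.exists_approximates φ.2.toIsHomZeroOne.demonic_top ∅ (by simp)
  exact ⟨_, H, hH, rfl⟩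

theorem directedOn_approxChoices {D : Type*} [PartialOrder D] [DcpoSemilattice D] {f : X → D}
    (hf : Monotone f) (φ : Aval X) : DirectedOn (· ≤ ·) (approxChoices f φ) := by
  rintro _ ⟨F, hF, rfl⟩ _ ⟨G, hG, rfl⟩
  obtain ⟨H, hH, h₁, h₂⟩ := hF.exists_upper_bound hf hG
  exact ⟨_, ⟨H, hH, rfl⟩, h₁, h₂⟩

/-! ### The basis of finite choices of points. -/

theorem Approximates.finChoice_etaP_le (h : Approximates F φ) :
    finChoice etaP F h.nonempty ≤ φ := by
  refine Aval.le_of_components (fun U hU => ?_) fun U hU => ?_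
  · rw [angelic_finChoice_etaP] at hU
    obtain ⟨x, hx, hxU⟩ := hU
    exact angelic_mono (wayAbove_le hxU) (h.angelic x hx)
  · rw [demonic_finChoice_etaP] at hU
    exact demonic_mono (wayAboveSet_le hU) h.demonic

theorem Approximates.wayBelow_finChoice_etaP (h : Approximates F φ) :
    WayBelow (finChoice etaP F h.nonempty) φ := fun d hne hd a ha hφa => by
  obtain ⟨ψ, hψ, hFψ⟩ := (h.mono hφa).exists_mem_of_isLUB hne hd ha
  exact ⟨ψ, hψ, hFψ.finChoice_etaP_le⟩

/-- Each component is recovered separately: if φ₁(U) = 1, some approximating set meets `U`; if φ₂(U)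
= 1, some approximating set lies in `U`. -/
theorem isLUB_approxChoices_etaP (φ : Aval X) : IsLUB (approxChoices etaP φ) φ := by
  refine ⟨?_, fun ψ hψ => Aval.le_of_components (fun U hU => ?_) fun U hU => ?_⟩
  · rintro _ ⟨F, hF, rfl⟩
    exact hF.finChoice_etaP_le
  · obtain ⟨H, hH, -, h⟩ := φ.exists_approximates φ.2.toIsHomZeroOne.demonic_top {U}
      (by simpa using hU)
    exact angelic_mono_left (hψ ⟨H, hH, rfl⟩)
      ((angelic_finChoice_etaP _ _ _).2 (h U (Finset.mem_singleton_self U)))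
  · obtain ⟨H, hH, h, -⟩ := φ.exists_approximates hU ∅ (by simp)
    exact demonic_mono_left (hψ ⟨H, hH, rfl⟩) ((demonic_finChoice_etaP _ _ _).2 h)

/-- There may be η(F) way below φ with `F` not approximating φ; `approx_of_subset` takes care of
them, since the approximating choices are cofinal. -/
theorem isDcpoBasis_finChoice_etaP : IsDcpoBasis
    {φ : Aval X | ∃ (F : Finset X) (hF : F.Nonempty), φ = finChoice etaP F hF} := fun φ =>
  approx_of_subset (by
    rintro _ ⟨F, hF, rfl⟩
    exact ⟨⟨F, _, rfl⟩, hF.wayBelow_finChoice_etaP⟩) (fun _ h => h.2)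
    (approxChoices_nonempty etaP φ) (directedOn_approxChoices scottContinuous_etaP.monotone φ)
    (isLUB_approxChoices_etaP φ)

theorem continuousDcpo_aval : ContinuousDcpo (Aval X) where
  exists_isLUB := Dcpo.exists_isLUB
  approx φ := approx_of_subset (by
    rintro _ ⟨F, hF, rfl⟩
    exact hF.wayBelow_finChoice_etaP) (fun _ h => h)
    (approxChoices_nonempty etaP φ) (directedOn_approxChoices scottContinuous_etaP.monotone φ)
    (isLUB_approxChoices_etaP φ)

/-! ### The extension of a continuous map -/

variable {D : Type*} [PartialOrder D] [DcpoSemilattice D] {f : X → D} {g : Aval X → D}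

/-- A set approximating a directed supremum already approximates a member, so every choice below `g
φ` is below some `g ψ` with `ψ ∈ d`. -/
theorem scottContinuous_of_isLUB_approxChoices
    (hg : ∀ φ, IsLUB (approxChoices f φ) (g φ)) : ScottContinuous g := by
  intro d hne hd φ hφ
  constructor
  · rintro _ ⟨ψ, hψ, rfl⟩
    refine (hg ψ).2 ?_
    rintro _ ⟨F, hF, rfl⟩
    exact (hg φ).1 ⟨F, hF.mono (hφ.1 hψ), rfl⟩
  · intro b hb
    refine (hg φ).2 ?_
    rintro _ ⟨F, hF, rfl⟩
    obtain ⟨ψ, hψ, hFψ⟩ := hF.exists_mem_of_isLUB hne hd hφ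
    exact ((hg ψ).1 ⟨F, hFψ, rfl⟩).trans (hb ⟨ψ, hψ, rfl⟩)

theorem map_op_of_isLUB_approxChoices (hf : Monotone f)
    (hg : ∀ φ, IsLUB (approxChoices f φ) (g φ)) (φ ψ : Aval X) :
    g (φ ⋓ ψ) = g φ ⋓ g ψ := by
  classical
  apply le_antisymm
  · refine (hg _).2 ?_
    rintro _ ⟨H, hH, rfl⟩
    have hdem : demonic φ.1 (wayAboveSet H) ∧ demonic ψ.1 (wayAboveSet H) :=
      demonic_op.1 hH.demonic
    -- `H` need not approximate φ or ψ separately: a point x of `H` may have φ₁(↟x) = 0 or ψ₁(↟x) =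
    -- 0, though not both. Each of the two sets obtained lies in ↟H and covers the points of `H`
    -- visible to its own valuation, so their union dominates `H`.
    have key : ∀ χ : Aval X, demonic χ.1 (wayAboveSet H) → ∃ F, Approximates F χ ∧
        (∀ y ∈ F, ∃ x ∈ H, x ≤ y) ∧
        ∀ x ∈ H, angelic χ.1 (wayAbove x) → ∃ y ∈ F, x ≤ y := by
      intro χ hχ
      obtain ⟨F, hF, h₁, h₂⟩ := χ.exists_approximates hχ
        ((H.filter fun x => angelic χ.1 (wayAbove x)).image wayAbove) (by
          intro V hV
          obtain ⟨x, hx, rfl⟩ := Finset.mem_image.1 hV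
          exact (Finset.mem_filter.1 hx).2)
      refine ⟨F, hF, fun y hy => ?_, fun x hx hxa => ?_⟩
      · obtain ⟨x, hx, hxy⟩ := mem_wayAboveSet.1 (h₁ y hy)
        exact ⟨x, hx, hxy.le⟩
      · obtain ⟨y, hy, hxy⟩ := h₂ _ (Finset.mem_image_of_mem _ (Finset.mem_filter.2 ⟨hx, hxa⟩))
        exact ⟨y, hy, (mem_wayAbove.1 hxy).le⟩
    obtain ⟨F, hF, hF₁, hF₂⟩ := key φ hdem.1
    obtain ⟨G, hG, hG₁, hG₂⟩ := key ψ hdem.2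
    calc finChoice f H hH.nonempty
        ≤ finChoice f (F ∪ G) hF.nonempty.inl := by
          refine finChoice_le_of_egliMilner hf _ _ (fun x hx => ?_) fun y hy =>
            (Finset.mem_union.1 hy).elim (hF₁ y) (hG₁ y)
          rcases angelic_op.1 (hH.angelic x hx) with h | h
          · obtain ⟨y, hy, hxy⟩ := hF₂ x hx h
            exact ⟨y, Finset.mem_union_left _ hy, hxy⟩
          · obtain ⟨y, hy, hxy⟩ := hG₂ x hx h
            exact ⟨y, Finset.mem_union_right _ hy, hxy⟩
      _ = finChoice f F hF.nonempty ⋓ finChoice f G hG.nonempty :=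
          finChoice_union f hF.nonempty hG.nonempty
      _ ≤ g φ ⋓ g ψ := op_mono ((hg φ).1 ⟨F, hF, rfl⟩) ((hg ψ).1 ⟨G, hG, rfl⟩)
  · refine (isLUB_op (approxChoices_nonempty f φ) (directedOn_approxChoices hf φ)
      (approxChoices_nonempty f ψ) (directedOn_approxChoices hf ψ) (hg φ) (hg ψ)).2 ?_
    rintro _ ⟨⟨_, _⟩, ⟨⟨F, hF, rfl⟩, ⟨G, hG, rfl⟩⟩, rfl⟩
    exact (hg (φ ⋓ ψ)).1 ⟨F ∪ G, hF.op hG, (finChoice_union f hF.nonempty hG.nonempty).symm⟩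

/-- Every set approximating `etaP x` consists of elements way below `x`, hence is Egli–Milner below
`{x}`. Conversely `{y}` approximates `etaP x` whenever y ≪ x, and continuity of `f` recovers `f x`
from these `f y`. -/
theorem apply_etaP_of_isLUB_approxChoices (hf : ScottContinuous f)
    (hg : ∀ φ, IsLUB (approxChoices f φ) (g φ)) (x : X) : g (etaP x) = f x := by
  apply le_antisymm
  · refine (hg _).2 ?_
    rintro _ ⟨F, hF, rfl⟩
    rw [← finChoice_singleton f x]
    refine finChoice_le_of_egliMilner hf.monotone _ _ (fun y hy => ?_) fun y hy => ?_
    · exact ⟨x, Finset.mem_singleton_self x,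
        (mem_wayAbove.1 (angelic_evalMap.1 (hF.angelic y hy))).le⟩
    · obtain rfl := Finset.mem_singleton.1 hy
      obtain ⟨z, hz, hzy⟩ := mem_wayAboveSet.1 (demonic_evalMap.1 hF.demonic)
      exact ⟨z, hz, hzy.le⟩
  · obtain ⟨hne, hdir, hlub⟩ := ContinuousDcpo.approx x
    refine (hf hne hdir hlub).2 ?_
    rintro _ ⟨y, hy, rfl⟩
    refine (hg _).1 ⟨{y}, ⟨fun z hz => ?_, ?_⟩, (finChoice_singleton f y).symm⟩
    · obtain rfl := Finset.mem_singleton.1 hz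
      exact angelic_evalMap.2 (mem_wayAbove.2 hy)
    · exact demonic_evalMap.2 (mem_wayAboveSet.2 ⟨y, Finset.mem_singleton_self y, hy⟩)

theorem IsDcpoSemilatticeHom.eq_of_apply_etaP {g' : Aval X → D} (hg : IsDcpoSemilatticeHom g)
    (hg' : IsDcpoSemilatticeHom g') (h : ∀ x, g (etaP x) = g' (etaP x)) : g = g' := by
  funext φ
  have h₁ := hg.continuous (approxChoices_nonempty etaP φ)
    (directedOn_approxChoices scottContinuous_etaP.monotone φ) (isLUB_approxChoices_etaP φ)
  have h₂ := hg'.continuous (approxChoices_nonempty etaP φ)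
    (directedOn_approxChoices scottContinuous_etaP.monotone φ) (isLUB_approxChoices_etaP φ)
  -- Homomorphisms agreeing on points agree on finite choices, and φ is a directed supremum of such
  -- choices.
  have e : g '' approxChoices etaP φ = g' '' approxChoices etaP φ := by
    refine Set.image_congr ?_
    rintro _ ⟨F, hF, rfl⟩
    rw [hg.map_finChoice, hg'.map_finChoice, show g ∘ etaP = g' ∘ etaP from funext h]
  rw [e] at h₁
  exact h₁.unique h₂

theorem isPlotkinPowerdomain_etaP : IsPlotkinPowerdomain.{v} (etaP : X → Aval X) where
  continuous := scottContinuous_etaP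
  existsUnique_extension D _ _ f hf := by
    choose g hg using fun φ : Aval X => Dcpo.exists_isLUB (approxChoices f φ)
      (approxChoices_nonempty f φ) (directedOn_approxChoices hf.monotone φ)
    have hgf := apply_etaP_of_isLUB_approxChoices hf hg
    have hghom : IsDcpoSemilatticeHom g := ⟨scottContinuous_of_isLUB_approxChoices hg,
      map_op_of_isLUB_approxChoices hf.monotone hg⟩
    exact ⟨g, ⟨hghom, hgf⟩, fun g' hg' =>
      hg'.1.eq_of_apply_etaP hghom fun x => (hg'.2 x).trans (hgf x).symm⟩

end Approximation

theorem theorem4p4 (X : Type u) [PartialOrder X] [ContinuousDcpo X] :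
    IsPlotkinPowerdomain.{v} (etaP : X → Aval X) ∧
    (∀ (P : Type u) [PartialOrder P] [DcpoSemilattice P] (ι : X → P),
      IsPlotkinPowerdomain.{u} ι →
        ∃ e : P ≃o Aval X, (∀ a b : P, e (a ⋓ b) = e a ⋓ e b) ∧ ∀ x : X, e (ι x) = etaP x) ∧
    ContinuousDcpo (Aval X) ∧
    IsDcpoBasis
      {φ : Aval X | ∃ (F : Finset X) (hF : F.Nonempty), φ = finChoice etaP F hF} := by
  exact ⟨isPlotkinPowerdomain_etaP,
    -- Each algebra serves as a test algebra for the other, so freeness of `etaP` is used here at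
    -- the universe `u` of `P` and `Aval X`, not at `v`.
    fun P _ _ ι hι => hι.exists_orderIso isPlotkinPowerdomain_etaP,
    continuousDcpo_aval, isDcpoBasis_finChoice_etaP⟩
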